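/- Let $w_1,\dots,w_n\in\mathbb{C}$ ($n\ge 1$) be distinct, let $\mu_1,\dots,\mu_n\ge 1$ be integers, and put $N=\sum_{j=1}^n\mu_j$, $p(z)=\prod_{j=1}^n(z-w_j)^{\mu_j}$ and $Z(z)=\begin{pmatrix}1&z&\cdots&z^{N-1}\end{pmatrix}$. Let $f$ be a rational $\mathbb{C}^{r\times s}$-valued function with no poles in $\{w_1,\dots,w_n\}$. A realization of $f$ of size $d$ is a triple of constant matrices $A\in\mathbb{C}^{d\times d}$, $B\in\mathbb{C}^{d\times s}$, $C\in\mathbb{C}^{rN\times d}$ such that $$f(z)=(Z(z)\otimes I_r)\,C\,(I-p(z)A)^{-1}B$$ as rational functions; it is called minimal if no realization of $f$ has a smaller size $d$. (1) A minimal realization is unique up to similarity: if $(A,B,C)$ and $(A',B',C')$ are minimal realizations of $f$, then they have the same size and there is an invertible matrix $S$ with $A'=S^{-1}AS$, $B'=S^{-1}B$, $C'=CS$. (2) Let $(A,B,C)$ be a minimal realization of $f$. Then the function $F(\lambda)=C(I-\lambda A)^{-1}B$ is a decomposition of $f$ in the following sense: it is analytic in an open neighborhood $\Omega_0$ of the origin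 such that $f$ has no poles in $p^{-1}(\Omega_0)$ and $f(z)=(Z(z)\otimes I_r)F(p(z))$ for all $z\in p^{-1}(\Omega_0)$. Moreover, whenever a $\mathbb{C}^{rN\times s}$-valued function $F$ is a decomposition of $f$ in this sense, $F$ is a polynomial near the origin if and only if $A$ is nilpotent. -/

import Mathlib

open Polynomial Topology
open scoped Kronecker

noncomputable section

namespace PRealization

/-- The polynomial `p(z) = ∏ j, (z - w j) ^ μ j`. -/
def nodePoly {n : ℕ} (w : Fin n → ℂ) (μ : Fin n → ℕ) : ℂ[X] :=
  ∏ j, (X - C (w j)) ^ μ j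

/-- The row vector `Z(x) = (1, x, …, x ^ (N - 1))`. -/
def rowZ {K : Type*} [CommRing K] (N : ℕ) (x : K) : Matrix Unit (Fin N) K :=
  Matrix.of fun _ k => x ^ (k : ℕ)

/-- The `r × rN` matrix `Z(x) ⊗ I_r` (the trivial row index of `Z(x)` is suppressed). -/
def kronZ {K : Type*} [CommRing K] (N r : ℕ) (x : K) :
    Matrix (Fin r) (Fin N × Fin r) K :=
  (rowZ N x ⊗ₖ (1 : Matrix (Fin r) (Fin r) K)).submatrix (fun i => ((), i)) id

/-- The matrix-valued rational function `f` has no pole at `z`. -/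
def RegularAt {r s : ℕ} (f : Matrix (Fin r) (Fin s) (RatFunc ℂ)) (z : ℂ) : Prop :=
  ∀ i j, (f i j).denom.eval z ≠ 0

/-- The value at `z` of a matrix-valued rational function (meaningful where it has no pole). -/
def valueAt {r s : ℕ} (f : Matrix (Fin r) (Fin s) (RatFunc ℂ)) (z : ℂ) :
    Matrix (Fin r) (Fin s) ℂ :=
  f.map (RatFunc.eval (RingHom.id ℂ) z)

/-- A triple of constant matrices, with `A` of size `d × d`. -/
structure Triple (N r s d : ℕ) where
  A : Matrix (Fin d) (Fin d) ℂ
  B : Matrix (Fin d) (Fin s) ℂ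
  C : Matrix (Fin N × Fin r) (Fin d) ℂ

/-- `f(z) = (Z(z) ⊗ I_r) C (I - p(z) A)⁻¹ B` as matrices over the field `ℂ(z)`. The matrix
`I - p A` is invertible over `ℂ(z)` as soon as `p` has a zero, since it is `I` there. -/
def IsRealization {N r s d : ℕ} (p : ℂ[X]) (f : Matrix (Fin r) (Fin s) (RatFunc ℂ))
    (R : Triple N r s d) : Prop :=
  f = kronZ N r (RatFunc.X : RatFunc ℂ) * R.C.map RatFunc.C *
    (1 - (algebraMap ℂ[X] (RatFunc ℂ) p) • R.A.map RatFunc.C)⁻¹ * R.B.map RatFunc.C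

/-- A realization for which the size of `A` is minimal among all realizations of `f`. -/
def IsMinimalRealization {N r s d : ℕ} (p : ℂ[X]) (f : Matrix (Fin r) (Fin s) (RatFunc ℂ))
    (R : Triple N r s d) : Prop :=
  IsRealization p f R ∧
    ∀ (d' : ℕ) (R' : Triple N r s d'), IsRealization p f R' → d ≤ d'

/-- Similarity of triples: an invertible `S`, with inverse `T`, such that
`A' = S⁻¹ A S`, `B' = S⁻¹ B`, `C' = C S`. (This forces `d = d'`.) -/
def Similar {N r s d d' : ℕ} (R : Triple N r s d) (R' : Triple N r s d') : Prop :=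
  ∃ (S : Matrix (Fin d) (Fin d') ℂ) (T : Matrix (Fin d') (Fin d) ℂ),
    S * T = 1 ∧ T * S = 1 ∧ R'.A = T * R.A * S ∧ R'.B = T * R.B ∧ R'.C = R.C * S

/-- `F` is analytic in an open neighborhood `Ω₀` of the origin, `f` has no pole in `p⁻¹(Ω₀)`,
and `f(z) = (Z(z) ⊗ I_r) F(p(z))` for all `z ∈ p⁻¹(Ω₀)`. -/
def IsDecomposition {N r s : ℕ} (p : ℂ[X]) (f : Matrix (Fin r) (Fin s) (RatFunc ℂ))
    (F : ℂ → Matrix (Fin N × Fin r) (Fin s) ℂ) : Prop :=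
  ∃ Ω₀ : Set ℂ, IsOpen Ω₀ ∧ (0 : ℂ) ∈ Ω₀ ∧
    (∀ i j, AnalyticOnNhd ℂ (fun x => F x i j) Ω₀) ∧
    ∀ z : ℂ, p.eval z ∈ Ω₀ →
      RegularAt f z ∧ valueAt f z = kronZ N r z * F (p.eval z)

/-- Near the origin, `F` is given by a matrix polynomial. -/
def IsPolynomialNearZero {N r s : ℕ} (F : ℂ → Matrix (Fin N × Fin r) (Fin s) ℂ) : Prop :=
  ∃ P : Matrix (Fin N × Fin r) (Fin s) ℂ[X], ∀ᶠ x in 𝓝 (0 : ℂ), F x = P.map (Polynomial.eval x)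

/-- The function `x ↦ C (I - x A)⁻¹ B`. -/
def Triple.transfer {N r s d : ℕ} (R : Triple N r s d) (x : ℂ) :
    Matrix (Fin N × Fin r) (Fin s) ℂ :=
  R.C * (1 - x • R.A)⁻¹ * R.B

end PRealization

end

/-! Put M_k = C A^k B. Iterating (I - pA)⁻¹ = I + pA(I - pA)⁻¹ turns a realization into a p-adic
expansion f = ∑ p^k (Z ⊗ I) M_k. Its digits have entries of degree below N = deg p, so f determines
all M_k (`moment_eq_of_isRealization`). Conversely, any triple with the same M_k realizes f
(`isRealization_of_moment_eq`). Realizing f is thus the classical problem of realizing a sequence of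
Markov parameters.

That problem is solved by the shift on the span of the Hankel columns. The observability map x ↦ (C
A^k x)_k intertwines A with this shift, and minimality makes it an isomorphism onto the span
(`obs_injective_and_range`). Two minimal triples are therefore similar, and A is nilpotent once M_k
vanishes for large k.

The M_k are also the Taylor coefficients at 0 of the transfer function, so that function is
polynomial near 0 exactly when A is nilpotent. Any other decomposition agrees with it near 0
(`IsDecomposition.eventuallyEq`), by interpolation on the fibres of p. -/

noncomputable section

/-! ### Markov parameters and p-adic expansion -/

namespace PRealization

open scoped Matrix

variable {N r s d d' : ℕ}

/-- The matrix polynomial `I - p A`. -/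
def pencil {d : ℕ} (p : ℂ[X]) (A : Matrix (Fin d) (Fin d) ℂ) : Matrix (Fin d) (Fin d) ℂ[X] :=
  1 - p • A.map Polynomial.C

/-- The Markov parameters `C A ^ k B`. -/
def Triple.moment (R : Triple N r s d) (k : ℕ) : Matrix (Fin N × Fin r) (Fin s) ℂ :=
  R.C * R.A ^ k * R.B

/-- The numerator of `C A ^ k (I - p A)⁻¹ B` over the denominator `det (I - p A)`. -/
def Triple.numerator (p : ℂ[X]) (R : Triple N r s d) (k : ℕ) :
    Matrix (Fin N × Fin r) (Fin s) ℂ[X] :=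
  (R.C * R.A ^ k).map Polynomial.C * (pencil p R.A).adjugate * R.B.map Polynomial.C

/-- The denominator `det (I - p A)`. -/
def Triple.denominator (p : ℂ[X]) (R : Triple N r s d) : ℂ[X] := (pencil p R.A).det

/-- The resolvent identity (I - pA)⁻¹ = I + pA(I - pA)⁻¹ with denominators cleared; it splits off
one p-adic digit. -/
theorem Triple.numerator_eq (p : ℂ[X]) (R : Triple N r s d) (k : ℕ) :
    R.numerator p k = R.denominator p • (R.moment k).map Polynomial.C + p • R.numerator p (k + 1) := by
  have h : (pencil p R.A).adjugate =
      R.denominator p • (1 : Matrix (Fin d) (Fin d) ℂ[X]) +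
        p • (R.A.map Polynomial.C * (pencil p R.A).adjugate) := by
    have := Matrix.mul_adjugate (pencil p R.A)
    rw [Triple.denominator, ← this]
    conv_rhs => enter [1, 1]; rw [pencil]
    rw [sub_mul, one_mul, Matrix.smul_mul]
    abel
  rw [Triple.numerator, h]
  simp only [Triple.numerator, Triple.moment, pow_succ, Matrix.map_mul, Matrix.mul_add,
    Matrix.add_mul, Matrix.mul_smul, Matrix.smul_mul, Matrix.mul_one, Matrix.mul_assoc]

theorem pencil_map {K : Type*} [CommRing K] (φ : ℂ[X] →+* K) (p : ℂ[X])
    (A : Matrix (Fin d) (Fin d) ℂ) :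
    (pencil p A).map φ = 1 - φ p • A.map (φ.comp Polynomial.C) := by
  ext i j
  simp [pencil, Matrix.one_apply, apply_ite φ]

theorem Triple.map_denominator {K : Type*} [CommRing K] (φ : ℂ[X] →+* K) (p : ℂ[X])
    (R : Triple N r s d) :
    φ (R.denominator p) = (1 - φ p • R.A.map (φ.comp Polynomial.C)).det := by
  rw [Triple.denominator, RingHom.map_det, ← pencil_map]; rfl

theorem Triple.map_numerator {K : Type*} [CommRing K] (φ : ℂ[X] →+* K) (p : ℂ[X])
    (R : Triple N r s d) (k : ℕ) :
    (R.numerator p k).map φ = (R.C * R.A ^ k).map (φ.comp Polynomial.C) *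
      (1 - φ p • R.A.map (φ.comp Polynomial.C)).adjugate * R.B.map (φ.comp Polynomial.C) := by
  rw [Triple.numerator, Matrix.map_mul, Matrix.map_mul, ← pencil_map, Matrix.map_map,
    Matrix.map_map, ← RingHom.mapMatrix_apply φ (pencil p R.A).adjugate,
    RingHom.map_adjugate, RingHom.mapMatrix_apply]
  rfl

theorem Triple.map_numerator_of_ne_zero {K : Type*} [Field K] (φ : ℂ[X] →+* K) (p : ℂ[X])
    (R : Triple N r s d) (k : ℕ) (h : φ (R.denominator p) ≠ 0) :
    (R.numerator p k).map φ = φ (R.denominator p) • ((R.C * R.A ^ k).map (φ.comp Polynomial.C) *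
      (1 - φ p • R.A.map (φ.comp Polynomial.C))⁻¹ * R.B.map (φ.comp Polynomial.C)) := by
  rw [R.map_denominator] at h
  rw [R.map_numerator, R.map_denominator, Matrix.inv_def, Ring.inverse_eq_inv', Matrix.mul_smul,
    Matrix.smul_mul, smul_smul, mul_inv_cancel₀ h, one_smul]

/-- Modulo p the pencil is the identity, so its determinant is 1. -/
theorem Triple.denominator_isCoprime (p : ℂ[X]) (R : Triple N r s d) :
    IsCoprime p (R.denominator p) := by
  have h : Ideal.Quotient.mk (Ideal.span {p}) (R.denominator p) = 1 := by
    rw [R.map_denominator, Ideal.Quotient.eq_zero_iff_mem.2 (Ideal.mem_span_singleton_self p)]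
    convert Matrix.det_one (n := Fin d) (R := ℂ[X] ⧸ Ideal.span {p})
    ext i j
    rw [Matrix.sub_apply, Matrix.smul_apply, smul_eq_mul, zero_mul, sub_zero]
  rw [← map_one (Ideal.Quotient.mk (Ideal.span {p})), Ideal.Quotient.eq,
    Ideal.mem_span_singleton] at h
  obtain ⟨c, hc⟩ := h
  exact ⟨-c, 1, by linear_combination hc⟩

theorem Triple.denominator_ne_zero {p : ℂ[X]} (hp : ¬ IsUnit p) (R : Triple N r s d) :
    R.denominator p ≠ 0 := by
  intro h
  have := R.denominator_isCoprime p
  rw [h, isCoprime_zero_right] at this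
  exact hp this

theorem kronZ_apply {K : Type*} [CommRing K] (N r : ℕ) (x : K) (i : Fin r)
    (k : Fin N × Fin r) : kronZ N r x i k = if i = k.2 then x ^ (k.1 : ℕ) else 0 := by
  simp [kronZ, rowZ, Matrix.one_apply, Matrix.kroneckerMap_apply]

theorem kronZ_mul_apply {K : Type*} [CommRing K] (x : K)
    (M : Matrix (Fin N × Fin r) (Fin s) K) (i : Fin r) (j : Fin s) :
    (kronZ N r x * M) i j = ∑ k : Fin N, x ^ (k : ℕ) * M (k, i) j := by
  simp [Matrix.mul_apply, kronZ_apply, Fintype.sum_prod_type]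

theorem kronZ_map {K L : Type*} [CommRing K] [CommRing L] (φ : K →+* L) (x : K) :
    (kronZ N r x).map φ = kronZ N r (φ x) := by
  ext i k
  simp [kronZ_apply, apply_ite φ]

theorem isRealization_iff {p : ℂ[X]} (hp : ¬ IsUnit p)
    (f : Matrix (Fin r) (Fin s) (RatFunc ℂ)) (R : Triple N r s d) :
    IsRealization p f R ↔ algebraMap ℂ[X] (RatFunc ℂ) (R.denominator p) • f =
      (kronZ N r (X : ℂ[X]) * R.numerator p 0).map (algebraMap ℂ[X] (RatFunc ℂ)) := by
  have hq : algebraMap ℂ[X] (RatFunc ℂ) (R.denominator p) ≠ 0 := by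
    simpa using R.denominator_ne_zero hp
  have hC : (algebraMap ℂ[X] (RatFunc ℂ)).comp Polynomial.C = RatFunc.C := by
    ext x; simp
  rw [Matrix.map_mul, kronZ_map, R.map_numerator_of_ne_zero _ _ _ hq, hC, Matrix.mul_smul,
    smul_right_inj hq, IsRealization]
  simp only [pow_zero, Matrix.mul_one, RatFunc.algebraMap_X, Matrix.mul_assoc]

/-- Every entry of `(Z ⊗ I) M` has degree less than `N`, so divisibility by `p` forces `M = 0`. -/
theorem eq_zero_of_dvd_kronZ {p : ℂ[X]} (hp : p.natDegree = N) (hN : 0 < N)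
    (M : Matrix (Fin N × Fin r) (Fin s) ℂ)
    (h : ∀ i j, p ∣ (kronZ N r (X : ℂ[X]) * M.map Polynomial.C) i j) : M = 0 := by
  ext ⟨k, i⟩ j
  have h1 := h i j
  have hp0 : p ≠ 0 := by rintro rfl; simp at hp; omega
  rw [kronZ_mul_apply] at h1
  have h2 := Polynomial.eq_zero_of_dvd_of_degree_lt h1 (by
    rw [Polynomial.degree_eq_natDegree hp0, hp]
    refine (Polynomial.degree_sum_le _ _).trans_lt ?_
    rw [Finset.sup_lt_iff (WithBot.bot_lt_coe _)]
    intro k _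
    rw [mul_comm]
    refine (Polynomial.degree_C_mul_X_pow_le _ _).trans_lt ?_
    exact_mod_cast k.2)
  have h3 := congrArg (fun g => Polynomial.coeff g k) h2
  simpa [Polynomial.finsetSum_coeff, Polynomial.coeff_X_pow, Fin.val_inj] using h3

/-- The numerator of the difference of `C A ^ k (I - p A)⁻¹ B` for two triples. -/
def diffNumerator (p : ℂ[X]) (R : Triple N r s d) (R' : Triple N r s d') (k : ℕ) :
    Matrix (Fin N × Fin r) (Fin s) ℂ[X] :=
  R'.denominator p • R.numerator p k - R.denominator p • R'.numerator p k

theorem diffNumerator_eq (p : ℂ[X]) (R : Triple N r s d) (R' : Triple N r s d') (k : ℕ) :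
    diffNumerator p R R' k =
      (R.denominator p * R'.denominator p) • (R.moment k - R'.moment k).map Polynomial.C +
        p • diffNumerator p R R' (k + 1) := by
  rw [diffNumerator, R.numerator_eq, R'.numerator_eq, diffNumerator]
  ext1 i j
  simp
  ring

theorem kronZ_mul_diffNumerator_eq_zero_iff {p : ℂ[X]} (hp : ¬ IsUnit p)
    (f : Matrix (Fin r) (Fin s) (RatFunc ℂ)) (R : Triple N r s d) (R' : Triple N r s d')
    (hR : IsRealization p f R) :
    kronZ N r (X : ℂ[X]) * diffNumerator p R R' 0 = 0 ↔ IsRealization p f R' := by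
  rw [isRealization_iff hp] at hR ⊢
  have hq : algebraMap ℂ[X] (RatFunc ℂ) (R.denominator p) ≠ 0 := by
    simpa using R.denominator_ne_zero hp
  have inj := RatFunc.algebraMap_injective ℂ
  rw [diffNumerator, Matrix.mul_sub, sub_eq_zero, Matrix.mul_smul, Matrix.mul_smul]
  simp only [← Matrix.ext_iff, Matrix.smul_apply, Matrix.map_apply, smul_eq_mul] at hR ⊢
  refine forall₂_congr fun i j => ?_
  rw [← inj.eq_iff, map_mul, map_mul, ← hR i j, mul_left_comm,
    mul_right_inj' hq]

/-- Uniqueness of p-adic digits: reduce the difference modulo p, conclude that the leading digits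
agree, divide by p and repeat. -/
theorem moment_eq_of_isRealization {p : ℂ[X]} (hpN : p.natDegree = N) (hN : 0 < N)
    (f : Matrix (Fin r) (Fin s) (RatFunc ℂ)) (R : Triple N r s d) (R' : Triple N r s d')
    (hR : IsRealization p f R) (hR' : IsRealization p f R') : R.moment = R'.moment := by
  have hp : ¬ IsUnit p := fun h => by
    have := Polynomial.natDegree_eq_zero_of_isUnit h; omega
  have hp0 : p ≠ 0 := by rintro rfl; simp at hpN; omega
  have key : ∀ k, kronZ N r (X : ℂ[X]) * diffNumerator p R R' k = 0 →
      R.moment k = R'.moment k ∧ kronZ N r (X : ℂ[X]) * diffNumerator p R R' (k + 1) = 0 := by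
    intro k hk
    rw [diffNumerator_eq, Matrix.mul_add, Matrix.mul_smul, Matrix.mul_smul] at hk
    have hM : R.moment k - R'.moment k = 0 := by
      refine eq_zero_of_dvd_kronZ hpN hN _ fun i j => ?_
      have h1 := congrFun (congrFun hk i) j
      -- Both denominators are units modulo p, so p must divide the remaining factor.
      refine ((R.denominator_isCoprime p).mul_right
        (R'.denominator_isCoprime p)).dvd_of_dvd_mul_left
        (⟨-(kronZ N r (X : ℂ[X]) * diffNumerator p R R' (k + 1)) i j, ?_⟩)
      simp only [Matrix.add_apply, Matrix.smul_apply, smul_eq_mul, Matrix.zero_apply] at h1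
      linear_combination h1
    refine ⟨sub_eq_zero.1 hM, ?_⟩
    rw [hM] at hk
    simpa [hp0] using hk
  have all : ∀ k, kronZ N r (X : ℂ[X]) * diffNumerator p R R' k = 0 := fun k => by
    induction k with
    | zero => exact (kronZ_mul_diffNumerator_eq_zero_iff hp f R R' hR).2 hR'
    | succ k ih => exact (key k ih).2
  exact funext fun k => (key k (all k)).1

theorem isRealization_of_moment_eq {p : ℂ[X]} (hp : ¬ IsUnit p)
    (f : Matrix (Fin r) (Fin s) (RatFunc ℂ)) (R : Triple N r s d) (R' : Triple N r s d')
    (hR : IsRealization p f R) (h : R.moment = R'.moment) : IsRealization p f R' := by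
  rw [← kronZ_mul_diffNumerator_eq_zero_iff hp f R R' hR]
  have hpow : ∀ k, diffNumerator p R R' 0 = p ^ k • diffNumerator p R R' k := fun k => by
    induction k with
    | zero => simp
    | succ k ih =>
      rw [ih, diffNumerator_eq, h, sub_self, pow_succ, mul_smul]
      ext1 i j
      simp [mul_assoc]
  have : diffNumerator p R R' 0 = 0 := by
    ext1 i j
    by_contra hne
    obtain ⟨m, hm⟩ := (FiniteMultiplicity.of_not_isUnit hp hne)
    -- Every power of p divides the entry, which is impossible for a nonzero polynomial and a
    -- nonunit p.
    exact hm ⟨_, congrFun (congrFun (hpow (m + 1)) i) j⟩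
  rw [this, Matrix.mul_zero]

end PRealization
-- Hankel realization and minimality
namespace PRealization

open scoped Matrix

variable {N r s d d' : ℕ}

/-- The backward shift on vector-valued sequences. -/
def shift (N r : ℕ) : (ℕ → Fin N × Fin r → ℂ) →ₗ[ℂ] (ℕ → Fin N × Fin r → ℂ) :=
  LinearMap.funLeft ℂ _ Nat.succ

@[simp]
theorem shift_apply (v : ℕ → Fin N × Fin r → ℂ) (k : ℕ) : shift N r v k = v (k + 1) := rfl

/-- The column `j` of the sequence `M`, shifted `k` times. -/
def hankelColumn (M : ℕ → Matrix (Fin N × Fin r) (Fin s) ℂ) (k : ℕ) (j : Fin s) :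
    ℕ → Fin N × Fin r → ℂ :=
  fun l i => M (l + k) i j

/-- The span of all columns of the block Hankel matrix of `M`. -/
def hankelSpan (M : ℕ → Matrix (Fin N × Fin r) (Fin s) ℂ) :
    Submodule ℂ (ℕ → Fin N × Fin r → ℂ) :=
  Submodule.span ℂ (Set.range fun kj : ℕ × Fin s => hankelColumn M kj.1 kj.2)

theorem hankelColumn_mem (M : ℕ → Matrix (Fin N × Fin r) (Fin s) ℂ) (k : ℕ) (j : Fin s) :
    hankelColumn M k j ∈ hankelSpan M :=
  Submodule.subset_span ⟨(k, j), rfl⟩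

theorem shift_hankelColumn (M : ℕ → Matrix (Fin N × Fin r) (Fin s) ℂ) (k : ℕ) (j : Fin s) :
    shift N r (hankelColumn M k j) = hankelColumn M (k + 1) j := by
  ext l i
  simp [hankelColumn, add_right_comm, add_assoc]

theorem shift_pow_hankelColumn (M : ℕ → Matrix (Fin N × Fin r) (Fin s) ℂ) (m k : ℕ)
    (j : Fin s) : (shift N r ^ m) (hankelColumn M k j) = hankelColumn M (k + m) j := by
  induction m with
  | zero => simp
  | succ m ih => rw [pow_succ', Module.End.mul_apply, ih, shift_hankelColumn, add_assoc]

theorem shift_mem_hankelSpan (M : ℕ → Matrix (Fin N × Fin r) (Fin s) ℂ) :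
    ∀ v ∈ hankelSpan M, shift N r v ∈ hankelSpan M := by
  change hankelSpan M ≤ (hankelSpan M).comap (shift N r)
  refine Submodule.span_le.2 ?_
  rintro _ ⟨⟨k, j⟩, rfl⟩
  rw [SetLike.mem_coe, Submodule.mem_comap, shift_hankelColumn]
  exact hankelColumn_mem M (k + 1) j

/-- The observability map `x ↦ (C A ^ k x)ₖ`. -/
def Triple.obs (R : Triple N r s d) : (Fin d → ℂ) →ₗ[ℂ] (ℕ → Fin N × Fin r → ℂ) :=
  LinearMap.pi fun k => (R.C * R.A ^ k).mulVecLin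

@[simp]
theorem Triple.obs_apply (R : Triple N r s d) (x : Fin d → ℂ) (k : ℕ) :
    R.obs x k = (R.C * R.A ^ k) *ᵥ x := rfl

theorem Triple.obs_mulVec (R : Triple N r s d) (x : Fin d → ℂ) :
    R.obs (R.A *ᵥ x) = shift N r (R.obs x) := by
  ext1 k
  simp [pow_succ, Matrix.mul_assoc]

theorem Triple.obs_pow_mulVec (R : Triple N r s d) (m : ℕ) (x : Fin d → ℂ) :
    R.obs (R.A ^ m *ᵥ x) = (shift N r ^ m) (R.obs x) := by
  induction m with
  | zero => simp
  | succ m ih =>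
    rw [pow_succ', pow_succ', Module.End.mul_apply, ← ih, ← R.obs_mulVec, Matrix.mulVec_mulVec]

theorem Triple.obs_col (R : Triple N r s d) (k : ℕ) (j : Fin s) :
    R.obs (R.A ^ k *ᵥ R.B.col j) = hankelColumn R.moment k j := by
  ext l i
  rw [R.obs_apply, Matrix.mulVec_mulVec, Matrix.mul_assoc, ← pow_add]
  rfl

theorem Triple.hankelSpan_le_range (R : Triple N r s d) :
    hankelSpan R.moment ≤ LinearMap.range R.obs := by
  refine Submodule.span_le.2 ?_
  rintro _ ⟨⟨k, j⟩, rfl⟩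
  exact ⟨_, R.obs_col k j⟩

instance (R : Triple N r s d) : FiniteDimensional ℂ (hankelSpan R.moment) :=
  Submodule.finiteDimensional_of_le R.hankelSpan_le_range

/-- The realization of the sequence `M` on a space of sequences with basis `b`. -/
def hankelTriple {m : ℕ} (M : ℕ → Matrix (Fin N × Fin r) (Fin s) ℂ)
    (b : Module.Basis (Fin m) ℂ (hankelSpan M)) : Triple N r s m where
  A := LinearMap.toMatrix b b ((shift N r).restrict (shift_mem_hankelSpan M))
  B := Matrix.of fun i j => b.repr ⟨hankelColumn M 0 j, hankelColumn_mem M 0 j⟩ i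
  C := Matrix.of fun i k => (b k : ℕ → Fin N × Fin r → ℂ) 0 i

/-- In coordinates, A^k B gives the columns shifted k times, and C reads off the term of index 0. -/
theorem hankelTriple_moment {m : ℕ} (M : ℕ → Matrix (Fin N × Fin r) (Fin s) ℂ)
    (b : Module.Basis (Fin m) ℂ (hankelSpan M)) : (hankelTriple M b).moment = M := by
  have hC : ∀ v : hankelSpan M, (hankelTriple M b).C *ᵥ b.repr v =
      (v : ℕ → Fin N × Fin r → ℂ) 0 := by
    intro v
    ext i
    have h := congrArg (fun u : hankelSpan M => (u : ℕ → Fin N × Fin r → ℂ) 0 i) (b.sum_repr v)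
    rw [← h]
    simp [-Module.Basis.sum_repr, hankelTriple, Matrix.mulVec, dotProduct, Finset.sum_apply,
      mul_comm]
  have hA : ∀ k j, (hankelTriple M b).A ^ k *ᵥ (hankelTriple M b).B.col j =
      b.repr ⟨hankelColumn M k j, hankelColumn_mem M k j⟩ := by
    intro k j
    induction k with
    | zero => rw [pow_zero, Matrix.one_mulVec]; rfl
    | succ k ih =>
      rw [pow_succ', ← Matrix.mulVec_mulVec, ih]
      refine (LinearMap.toMatrix_mulVec_repr b b _ _).trans ?_
      congr 2
      exact Subtype.ext (shift_hankelColumn M k j)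
  ext k i j
  have h := congrFun (hC ⟨hankelColumn M k j, hankelColumn_mem M k j⟩) i
  rw [← hA, Matrix.mulVec_mulVec] at h
  simpa [Triple.moment, Matrix.mul_assoc, hankelColumn, Matrix.mulVec, Matrix.mul_apply_eq_vecMul,
    Matrix.mul_apply, dotProduct] using h

/-- Comparison with the Hankel triple gives d ≤ dim(Hankel span) ≤ rank(obs) ≤ d, so equality holds
throughout. -/
theorem IsMinimalRealization.obs_injective_and_range {p : ℂ[X]} (hp : ¬ IsUnit p)
    {f : Matrix (Fin r) (Fin s) (RatFunc ℂ)} {R : Triple N r s d}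
    (hR : IsMinimalRealization p f R) :
    Function.Injective R.obs ∧ LinearMap.range R.obs = hankelSpan R.moment := by
  have h1 := hR.2 _ (hankelTriple R.moment (Module.finBasis ℂ _))
    (isRealization_of_moment_eq hp f R _ hR.1 (hankelTriple_moment _ _).symm)
  have h2 := Submodule.finrank_mono R.hankelSpan_le_range
  have h3 := R.obs.finrank_range_add_finrank_ker
  rw [Module.finrank_fin_fun] at h3
  refine ⟨LinearMap.ker_eq_bot.1 (Submodule.finrank_eq_zero.1 (by omega)), ?_⟩
  exact (Submodule.eq_of_le_of_finrank_le R.hankelSpan_le_range (by omega)).symm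

/-- Both state spaces are identified with the common range, where A is the shift, C is evaluation at
index 0, and the columns of B are the unshifted Hankel columns. -/
theorem similar_of_obs {R : Triple N r s d} {R' : Triple N r s d'}
    (hi : Function.Injective R.obs) (hi' : Function.Injective R'.obs)
    (hr : LinearMap.range R.obs = LinearMap.range R'.obs) (hM : R.moment = R'.moment) :
    Similar R R' := by
  let e : (Fin d → ℂ) ≃ₗ[ℂ] (Fin d' → ℂ) := (LinearEquiv.ofInjective R.obs hi).trans
    ((LinearEquiv.ofEq _ _ hr).trans (LinearEquiv.ofInjective R'.obs hi').symm)
  have he : ∀ x, R'.obs (e x) = R.obs x := fun x => by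
    have := congrArg Subtype.val ((LinearEquiv.ofInjective R'.obs hi').apply_symm_apply
      (LinearEquiv.ofEq _ _ hr (LinearEquiv.ofInjective R.obs hi x)))
    exact this
  have he' : ∀ x, R.obs (e.symm x) = R'.obs x := fun x => by
    rw [← he, e.apply_symm_apply]
  have hT : ∀ x, LinearMap.toMatrix' e.toLinearMap *ᵥ x = e x := fun x =>
    LinearMap.toMatrix'_mulVec _ _
  have hS : ∀ x, LinearMap.toMatrix' e.symm.toLinearMap *ᵥ x = e.symm x := fun x =>
    LinearMap.toMatrix'_mulVec _ _
  refine ⟨LinearMap.toMatrix' e.symm.toLinearMap, LinearMap.toMatrix' e.toLinearMap,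
    ?_, ?_, ?_, ?_, ?_⟩
  · rw [← LinearMap.toMatrix'_comp]; simp
  · rw [← LinearMap.toMatrix'_comp]; simp
  · refine Matrix.ext_iff_mulVec.2 fun x => hi' ?_
    rw [← Matrix.mulVec_mulVec, ← Matrix.mulVec_mulVec, hS, hT, he, R.obs_mulVec, he',
      R'.obs_mulVec]
  · refine Matrix.ext_of_mulVec_single fun j => hi' ?_
    have h := R.obs_col 0 j
    have h' := R'.obs_col 0 j
    rw [← Matrix.mulVec_mulVec, hT, he, Matrix.mulVec_single_one, Matrix.mulVec_single_one]
    rw [pow_zero, Matrix.one_mulVec] at h h'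
    rw [h, h', hM]
  · refine Matrix.ext_iff_mulVec.2 fun x => ?_
    rw [← Matrix.mulVec_mulVec, hS]
    simpa using (congrFun (he' x) 0).symm

/-- The m-th power of the shift kills every Hankel column, and the observability map carries this
back to A ^ m = 0. -/
theorem IsMinimalRealization.isNilpotent {p : ℂ[X]} (hp : ¬ IsUnit p)
    {f : Matrix (Fin r) (Fin s) (RatFunc ℂ)} {R : Triple N r s d}
    (hR : IsMinimalRealization p f R) {m : ℕ} (hm : ∀ k, m ≤ k → R.moment k = 0) :
    IsNilpotent R.A := by
  obtain ⟨hi, hr⟩ := hR.obs_injective_and_range hp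
  refine ⟨m, Matrix.ext_iff_mulVec.2 fun x => hi ?_⟩
  have hle : hankelSpan R.moment ≤ LinearMap.ker (shift N r ^ m) := by
    refine Submodule.span_le.2 ?_
    rintro _ ⟨⟨k, j⟩, rfl⟩
    rw [SetLike.mem_coe, LinearMap.mem_ker, shift_pow_hankelColumn]
    ext l i
    simp [hankelColumn, hm (l + (k + m)) (by omega)]
  rw [R.obs_pow_mulVec, Matrix.zero_mulVec, map_zero]
  exact hle (hr ▸ ⟨x, rfl⟩)

end PRealization
-- Transfer functions, polynomiality and decompositions
namespace PRealization

open scoped Matrix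

variable {N r s d d' : ℕ}

/-- The function `x ↦ C A ^ k (I - x A)⁻¹ B`. -/
def Triple.tail (R : Triple N r s d) (k : ℕ) (x : ℂ) : Matrix (Fin N × Fin r) (Fin s) ℂ :=
  R.C * R.A ^ k * (1 - x • R.A)⁻¹ * R.B

theorem Triple.tail_zero_left (R : Triple N r s d) : R.tail 0 = R.transfer := by
  ext1 x
  simp [Triple.tail, Triple.transfer]

theorem Triple.tail_zero_right (R : Triple N r s d) (k : ℕ) : R.tail k 0 = R.moment k := by
  simp [Triple.tail, Triple.moment]

theorem Triple.eval_denominator (p : ℂ[X]) (R : Triple N r s d) (z : ℂ) :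
    (R.denominator p).eval z = (1 - p.eval z • R.A).det := by
  have h := R.map_denominator (evalRingHom z) p
  have hC : (evalRingHom z).comp Polynomial.C = RingHom.id ℂ := by ext; simp
  rwa [hC, RingHom.coe_id, Matrix.map_id] at h

theorem Triple.eval_numerator (p : ℂ[X]) (R : Triple N r s d) (k : ℕ) (z : ℂ)
    (h : (R.denominator p).eval z ≠ 0) :
    (R.numerator p k).map (eval z) = (R.denominator p).eval z • R.tail k (p.eval z) := by
  have h := R.map_numerator_of_ne_zero (evalRingHom z) p k h
  have hC : (evalRingHom z).comp Polynomial.C = RingHom.id ℂ := by ext; simp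
  rwa [hC, RingHom.coe_id, Matrix.map_id, Matrix.map_id, Matrix.map_id] at h

/-- The set where `I - x A` is invertible. -/
def Triple.domain (R : Triple N r s d) : Set ℂ := {x | (R.denominator X).eval x ≠ 0}

theorem Triple.isOpen_domain (R : Triple N r s d) : IsOpen R.domain :=
  isOpen_ne_fun (R.denominator X).continuous continuous_const

theorem Triple.zero_mem_domain (R : Triple N r s d) : (0 : ℂ) ∈ R.domain := by
  simp [Triple.domain, R.eval_denominator]

theorem Triple.domain_mem_nhds (R : Triple N r s d) : R.domain ∈ 𝓝 (0 : ℂ) :=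
  R.isOpen_domain.mem_nhds R.zero_mem_domain

theorem Triple.tail_apply (R : Triple N r s d) (k : ℕ) {x : ℂ} (hx : x ∈ R.domain)
    (i : Fin N × Fin r) (j : Fin s) :
    R.tail k x i j = (R.numerator X k i j).eval x / (R.denominator X).eval x := by
  have h := congrFun (congrFun (R.eval_numerator X k x hx) i) j
  rw [Matrix.map_apply, Matrix.smul_apply, eval_X, smul_eq_mul] at h
  rw [h, mul_div_cancel_left₀ _ hx]

theorem Triple.analyticOnNhd_tail (R : Triple N r s d) (k : ℕ) (i : Fin N × Fin r)
    (j : Fin s) : AnalyticOnNhd ℂ (fun x => R.tail k x i j) R.domain := by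
  intro x hx
  have h : AnalyticAt ℂ
      (fun x => (R.numerator X k i j).eval x / (R.denominator X).eval x) x :=
    (AnalyticOnNhd.eval_polynomial _ x trivial).div
      (AnalyticOnNhd.eval_polynomial _ x trivial) hx
  refine h.congr ?_
  filter_upwards [R.isOpen_domain.mem_nhds hx] with y hy
  exact (R.tail_apply k hy i j).symm

theorem Triple.tail_eq (R : Triple N r s d) (k : ℕ) {x : ℂ} (hx : x ∈ R.domain)
    (i : Fin N × Fin r) (j : Fin s) :
    R.tail k x i j = R.moment k i j + x * R.tail (k + 1) x i j := by
  have h := congrFun (congrFun (R.numerator_eq X k) i) j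
  have hx' : (R.denominator X).eval x ≠ 0 := hx
  rw [R.tail_apply k hx, R.tail_apply (k + 1) hx, h]
  simp only [Matrix.add_apply, Matrix.smul_apply, Matrix.map_apply, smul_eq_mul, eval_add,
    eval_mul, eval_C, eval_X]
  field_simp

theorem Triple.tail_eq_sum (R : Triple N r s d) {x : ℂ} (hx : x ∈ R.domain)
    (i : Fin N × Fin r) (j : Fin s) (m : ℕ) :
    R.tail 0 x i j = ∑ k ∈ Finset.range m, R.moment k i j * x ^ k + x ^ m * R.tail m x i j := by
  induction m with
  | zero => simp
  | succ m ih =>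
    rw [ih, R.tail_eq m hx, Finset.sum_range_succ]
    ring

/-- If `g k = g k 0 + x g (k + 1)` near the origin and `g 0` is polynomial near the origin, then
the values `g k 0` are the coefficients of that polynomial. -/
theorem coeff_eq_of_eventually {g : ℕ → ℂ → ℂ} (hc : ∀ k, ContinuousAt (g k) 0)
    (hg : ∀ k, ∀ᶠ x in 𝓝 (0 : ℂ), g k x = g k 0 + x * g (k + 1) x) (P : ℂ[X])
    (hP : ∀ᶠ x in 𝓝[≠] (0 : ℂ), g 0 x = P.eval x) (k : ℕ) : g k 0 = P.coeff k := by
  have step : ∀ k (Q : ℂ[X]), (∀ᶠ x in 𝓝[≠] (0 : ℂ), g k x = Q.eval x) →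
      g k 0 = Q.coeff 0 := fun k Q hQ => by
    rw [coeff_zero_eq_eval_zero]
    refine tendsto_nhds_unique (l := 𝓝[≠] 0)
      ((hc k).tendsto.mono_left nhdsWithin_le_nhds) ?_
    refine Filter.Tendsto.congr' (hQ.mono fun x hx => hx.symm) ?_
    exact (Q.continuous.tendsto 0).mono_left nhdsWithin_le_nhds
  have main : ∀ k, ∃ Q : ℂ[X], (∀ l, Q.coeff l = P.coeff (l + k)) ∧
      ∀ᶠ x in 𝓝[≠] (0 : ℂ), g k x = Q.eval x := fun k => by
    induction k with
    | zero => exact ⟨P, fun l => rfl, hP⟩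
    | succ k ih =>
      obtain ⟨Q, hQP, hQ⟩ := ih
      refine ⟨Q.divX, fun l => by rw [coeff_divX, hQP]; congr 1; ring, ?_⟩
      filter_upwards [hQ, nhdsWithin_le_nhds (hg k), self_mem_nhdsWithin] with x h1 h2 hx
      have h3 := congrArg (eval x) Q.divX_mul_X_add
      rw [eval_add, eval_mul, eval_X, eval_C, ← step k Q hQ, ← h1, h2] at h3
      have hx' : x ≠ 0 := hx
      -- Cancelling x is why the induction runs on punctured neighborhoods.
      refine mul_left_cancel₀ hx' ?_
      linear_combination -h3
  obtain ⟨Q, hQP, hQ⟩ := main k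
  rw [step k Q hQ, hQP, zero_add]

theorem Triple.moment_eq_coeff (R : Triple N r s d)
    (P : Matrix (Fin N × Fin r) (Fin s) ℂ[X])
    (hP : ∀ᶠ x in 𝓝 (0 : ℂ), R.transfer x = P.map (eval x)) (k : ℕ) (i : Fin N × Fin r)
    (j : Fin s) : R.moment k i j = (P i j).coeff k := by
  rw [← R.tail_zero_right]
  refine coeff_eq_of_eventually (g := fun k x => R.tail k x i j)
    (fun k => (R.analyticOnNhd_tail k i j 0 R.zero_mem_domain).continuousAt)
    (fun k => ?_) _ ?_ k
  · filter_upwards [R.domain_mem_nhds] with x hx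
    rw [R.tail_zero_right, R.tail_eq k hx]
  · filter_upwards [nhdsWithin_le_nhds hP] with x hx
    rw [R.tail_zero_left, hx, Matrix.map_apply]

theorem Triple.isPolynomialNearZero_transfer (R : Triple N r s d) (h : IsNilpotent R.A) :
    IsPolynomialNearZero R.transfer := by
  obtain ⟨m, hm⟩ := h
  refine ⟨Matrix.of fun i j => ∑ k ∈ Finset.range m, Polynomial.C (R.moment k i j) * X ^ k, ?_⟩
  filter_upwards [R.domain_mem_nhds] with x hx
  ext i j
  rw [← R.tail_zero_left, R.tail_eq_sum hx i j m]
  simp [Triple.tail, hm, eval_finsetSum]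

theorem IsMinimalRealization.isPolynomialNearZero_transfer_iff {p : ℂ[X]} (hp : ¬ IsUnit p)
    {f : Matrix (Fin r) (Fin s) (RatFunc ℂ)} {R : Triple N r s d}
    (hR : IsMinimalRealization p f R) :
    IsPolynomialNearZero R.transfer ↔ IsNilpotent R.A := by
  refine ⟨fun ⟨P, hP⟩ => ?_, R.isPolynomialNearZero_transfer⟩
  -- One more than the largest degree among the entries of P.
  refine hR.isNilpotent hp (m := (Finset.univ.sup fun ij : (Fin N × Fin r) × Fin s =>
    (P ij.1 ij.2).natDegree) + 1) fun k hk => ?_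
  ext i j
  rw [R.moment_eq_coeff P hP]
  refine coeff_eq_zero_of_natDegree_lt ((Nat.lt_of_succ_le hk).trans_le' ?_)
  exact Finset.le_sup (f := fun ij : (Fin N × Fin r) × Fin s => (P ij.1 ij.2).natDegree)
    (Finset.mem_univ (i, j))

theorem IsRealization.isDecomposition_transfer {p : ℂ[X]} (hp : ¬ IsUnit p)
    {f : Matrix (Fin r) (Fin s) (RatFunc ℂ)} {R : Triple N r s d} (hR : IsRealization p f R) :
    IsDecomposition p f R.transfer := by
  refine ⟨R.domain, R.isOpen_domain, R.zero_mem_domain,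
    fun i j => R.tail_zero_left ▸ R.analyticOnNhd_tail 0 i j, fun z hz => ?_⟩
  -- Both det(I - xA) at x = p(z) and det(I - pA) at z equal det(I - p(z)A).
  have hq : (R.denominator p).eval z ≠ 0 := by
    have : (R.denominator X).eval (p.eval z) ≠ 0 := hz
    rwa [R.eval_denominator, eval_X, ← R.eval_denominator p] at this
  have hq0 := R.denominator_ne_zero hp
  have hq0' : algebraMap ℂ[X] (RatFunc ℂ) (R.denominator p) ≠ 0 := by simpa using hq0
  rw [isRealization_iff hp] at hR
  have hf : ∀ i j, algebraMap ℂ[X] (RatFunc ℂ) (R.denominator p) * f i j =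
      algebraMap ℂ[X] (RatFunc ℂ) ((kronZ N r (X : ℂ[X]) * R.numerator p 0) i j) := fun i j =>
    congrFun (congrFun hR i) j
  have hreg : RegularAt f z := fun i j h0 => by
    have hd : (f i j).denom ∣ R.denominator p :=
      (RatFunc.denom_dvd hq0).2 ⟨_, eq_div_of_mul_eq hq0' ((mul_comm _ _).trans (hf i j))⟩
    exact hq (eval_eq_zero_of_dvd_of_eval_eq_zero hd h0)
  refine ⟨hreg, ?_⟩
  ext i j
  have h := congrArg (RatFunc.eval (RingHom.id ℂ) z) (hf i j)
  have hnum := R.eval_numerator p 0 z hq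
  have hval : ((kronZ N r (X : ℂ[X]) * R.numerator p 0) i j).eval z =
      (R.denominator p).eval z * (kronZ N r z * R.tail 0 (p.eval z)) i j := by
    rw [← smul_eq_mul, ← Matrix.smul_apply, ← Matrix.mul_smul, ← hnum, kronZ_mul_apply,
      kronZ_mul_apply, eval_finsetSum]
    simp
  rw [RatFunc.eval_mul _ _ (by simp) (by simpa [eval₂_id] using hreg i j),
    RatFunc.eval_algebraMap, RatFunc.eval_algebraMap] at h
  simp only [Algebra.algebraMap_self, RingHom.id_apply, eval₂_id, hval] at h
  rw [← R.tail_zero_left]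
  exact mul_left_cancel₀ hq h

/-- Since x is not a critical value, p - x has N distinct roots. Each entry-wise combination ∑ M_k
z^k has degree below N and vanishes at all of them. -/
theorem eq_zero_of_kronZ_mul_eq_zero {p : ℂ[X]} (hpN : p.natDegree = N) (hN : 0 < N) {x : ℂ}
    (hx : ∀ z, p.eval z = x → p.derivative.eval z ≠ 0) (M : Matrix (Fin N × Fin r) (Fin s) ℂ)
    (h : ∀ z, p.eval z = x → kronZ N r z * M = 0) : M = 0 := by
  have hdeg : (p - Polynomial.C x).natDegree = N := by rw [natDegree_sub_C, hpN]
  have hne : p - Polynomial.C x ≠ 0 := by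
    intro h0; rw [h0, natDegree_zero] at hdeg; omega
  have hroot : ∀ z ∈ (p - Polynomial.C x).roots, p.eval z = x := fun z hz => by
    have := (mem_roots hne).1 hz
    simpa [IsRoot, sub_eq_zero] using this
  have hnodup : (p - Polynomial.C x).roots.Nodup := by
    rw [Multiset.nodup_iff_count_le_one]
    intro z
    rw [count_roots]
    by_contra! hlt
    obtain ⟨h1, h2⟩ := (one_lt_rootMultiplicity_iff_isRoot hne).1 hlt
    refine hx z (by simpa [IsRoot, sub_eq_zero] using h1) ?_
    simpa [IsRoot] using h2
  have hcard : (p - Polynomial.C x).roots.toFinset.card = N := by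
    rw [Multiset.toFinset_card_of_nodup hnodup, ← hdeg]
    exact (IsAlgClosed.splits _).natDegree_eq_card_roots.symm
  ext ⟨k, i⟩ j
  have hg : ∑ k : Fin N, Polynomial.C (M (k, i) j) * X ^ (k : ℕ) = 0 := by
    refine eq_zero_of_natDegree_lt_card_of_eval_eq_zero' _
      (p - Polynomial.C x).roots.toFinset (fun z hz => ?_) ?_
    · have := congrFun (congrFun (h z (hroot z (Multiset.mem_toFinset.1 hz))) i) j
      rw [kronZ_mul_apply] at this
      rw [eval_finsetSum]
      refine (Finset.sum_congr rfl fun k _ => ?_).trans this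
      rw [eval_mul, eval_C, eval_pow, eval_X, mul_comm]
    · rw [hcard]
      refine (natDegree_sum_le_of_forall_le (n := N - 1) _ _ fun k _ => ?_).trans_lt (by omega)
      exact (natDegree_C_mul_X_pow_le _ _).trans (by omega)
  have h3 := congrArg (fun g => Polynomial.coeff g k) hg
  simpa [finsetSum_coeff, coeff_X_pow, Fin.val_inj] using h3

/-- There are finitely many critical values of p, so interpolation on fibres gives equality on a
punctured neighborhood of 0. -/
theorem IsDecomposition.eventuallyEq {p : ℂ[X]} (hpN : p.natDegree = N) (hN : 0 < N)
    {f : Matrix (Fin r) (Fin s) (RatFunc ℂ)} {F G : ℂ → Matrix (Fin N × Fin r) (Fin s) ℂ}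
    (hF : IsDecomposition p f F) (hG : IsDecomposition p f G) : F =ᶠ[𝓝 0] G := by
  obtain ⟨U, hU, hU0, hFa, hFv⟩ := hF
  obtain ⟨V, hV, hV0, hGa, hGv⟩ := hG
  have hd : p.derivative ≠ 0 := fun h => by
    have := derivative_eq_zero.1 h; omega
  have hcrit : ∀ᶠ x in 𝓝[≠] (0 : ℂ), x ∉ p.derivative.roots.toFinset.image (eval · p) :=
    nhdsNE_le_cofinite 0 (Finset.finite_toSet _).compl_mem_cofinite
  have hne : ∀ᶠ x in 𝓝[≠] (0 : ℂ), F x = G x := by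
    filter_upwards [nhdsWithin_le_nhds (hU.mem_nhds hU0), nhdsWithin_le_nhds (hV.mem_nhds hV0),
      hcrit] with x hxU hxV hx
    rw [← sub_eq_zero]
    refine eq_zero_of_kronZ_mul_eq_zero hpN hN (x := x) (fun z hz h0 => hx ?_) _ fun z hz => ?_
    · exact Finset.mem_image.2 ⟨z, Multiset.mem_toFinset.2 ((mem_roots hd).2 h0), hz⟩
    · subst hz
      rw [Matrix.mul_sub, ← (hFv z hxU).2, ← (hGv z hxV).2, sub_self]
  -- 0 may itself be a critical value (a multiple node), so equality there comes from continuity.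
  have h0 : F 0 = G 0 := by
    ext i j
    refine tendsto_nhds_unique (l := 𝓝[≠] 0) (((hFa i j 0 hU0).continuousAt.tendsto).mono_left
      nhdsWithin_le_nhds) (Filter.Tendsto.congr' ?_
        (((hGa i j 0 hV0).continuousAt.tendsto).mono_left nhdsWithin_le_nhds))
    filter_upwards [hne] with x hx
    rw [hx]
  rw [eventually_nhdsWithin_iff] at hne
  filter_upwards [hne] with x hx
  by_cases hx0 : x = 0
  · rw [hx0, h0]
  · exact hx hx0

theorem IsPolynomialNearZero.congr {F G : ℂ → Matrix (Fin N × Fin r) (Fin s) ℂ}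
    (hF : IsPolynomialNearZero F) (h : F =ᶠ[𝓝 0] G) : IsPolynomialNearZero G := by
  obtain ⟨P, hP⟩ := hF
  refine ⟨P, ?_⟩
  filter_upwards [hP, h] with x h1 h2
  rw [← h2, h1]

theorem natDegree_nodePoly {n : ℕ} (w : Fin n → ℂ) (μ : Fin n → ℕ) :
    (nodePoly w μ).natDegree = ∑ j, μ j := by
  rw [nodePoly, natDegree_prod_of_monic _ _ fun j _ => (monic_X_sub_C _).pow _]
  simp

end PRealization

end

theorem corollary3p6 {n : ℕ} (hn : 0 < n) (w : Fin n → ℂ) (hw : Function.Injective w)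
    (μ : Fin n → ℕ) (hμ : ∀ j, 0 < μ j) {r s : ℕ}
    (f : Matrix (Fin r) (Fin s) (RatFunc ℂ))
    (hf : ∀ j, PRealization.RegularAt f (w j)) :
    (∀ (d d' : ℕ) (R : PRealization.Triple (∑ j, μ j) r s d)
        (R' : PRealization.Triple (∑ j, μ j) r s d'),
      PRealization.IsMinimalRealization (PRealization.nodePoly w μ) f R →
      PRealization.IsMinimalRealization (PRealization.nodePoly w μ) f R' →
      PRealization.Similar R R') ∧
    (∀ (d : ℕ) (R : PRealization.Triple (∑ j, μ j) r s d),
      PRealization.IsMinimalRealization (PRealization.nodePoly w μ) f R →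
      PRealization.IsDecomposition (PRealization.nodePoly w μ) f R.transfer ∧
      ∀ F : ℂ → Matrix (Fin (∑ j, μ j) × Fin r) (Fin s) ℂ,
        PRealization.IsDecomposition (PRealization.nodePoly w μ) f F →
        (PRealization.IsPolynomialNearZero F ↔ IsNilpotent R.A)) := by
  have hN : 0 < ∑ j, μ j :=
    (hμ ⟨0, hn⟩).trans_le (Finset.single_le_sum (fun _ _ => Nat.zero_le _) (Finset.mem_univ _))
  have hdeg := PRealization.natDegree_nodePoly w μ
  have hp : ¬ IsUnit (PRealization.nodePoly w μ) := fun h => by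
    have := Polynomial.natDegree_eq_zero_of_isUnit h
    omega
  refine ⟨fun d d' R R' hR hR' => ?_, fun d R hR => ?_⟩
  · have hM := PRealization.moment_eq_of_isRealization hdeg hN f R R' hR.1 hR'.1
    obtain ⟨hi, hr⟩ := hR.obs_injective_and_range hp
    obtain ⟨hi', hr'⟩ := hR'.obs_injective_and_range hp
    exact PRealization.similar_of_obs hi hi' (by rw [hr, hr', hM]) hM
  · have hT := hR.1.isDecomposition_transfer hp
    refine ⟨hT, fun F hF => ?_⟩
    rw [← hR.isPolynomialNearZero_transfer_iff hp]
    have heq := hF.eventuallyEq hdeg hN hT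
    exact ⟨fun h => h.congr heq, fun h => h.congr heq.symm⟩
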